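/- Let $G$ be a finite group, let $D(G)$ be its Drinfeld double over $\mathbb C$, let $m$ be an integer and let $d$ be a divisor of $\exp(G)$. For $g\in G$ and $\eta\in\mathrm{Irr}(C_G(g))$ (an irreducible complex character of the centralizer of $g$) let $\nu_m(g,\eta)$ denote the $m$-th Frobenius–Schur indicator of the simple $D(G)$-module $M(g,\eta)$ associated with the pair $(g,\eta)$; that is, $\nu_m(g,\eta)=\chi_{M(g,\eta)}(\Lambda_{(1)}\Lambda_{(2)}\cdots\Lambda_{(m)})$, where $\chi_M$ is the character of $M$ and $\Lambda$ is the normalized integral of $D(G)$ (for $m\le 0$ the Sweedler power is the $m$-th power of the identity map in the convolution algebra $\mathrm{End}_{\mathbb C}(D(G))$, applied to $\Lambda$). For $z\in G$ let $$\gamma_m^z\colon C_G(z)\to\mathbb C,\qquad \gamma_m^z(g)=|\{x\in G : x^m=(gx)^m=z\}|.$$ For an integer $r$ let $\psi^r$ be the Adams operator on class functions, $(\psi^r\chi)(g)=\chi(g^r)$, and write $\mathbb Q(\zeta_d)\subset\mathbb C$ for the $d$-th cyclotomic field. Then the following are equivalent: 1. $\nu_m(g,\eta)\in\mathbb Q(\zeta_d)$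 for all $g\in G$ and all $\eta\in\mathrm{Irr}(C_G(g))$. 2. $\psi^r\gamma_m^z=\gamma_m^z$ for all $z\in G$ and all integers $r$ with $\gcd(r,\exp(G))=1$ and $r\equiv 1\pmod d$. -/

import Mathlib

universe u

open scoped TensorProduct

noncomputable section

namespace DrinfeldIndicator

/-! ### The Drinfeld double of a finite group -/

/-- The underlying complex vector space of the Drinfeld double `D(G)`, with basis the elements
`e_a ⋈ x` for `a x : G`. Here `e_a` is the indicator function of `a`. -/
def Double (G : Type u) : Type u := G × G →₀ ℂ

namespace Double

section Linear

variable {G : Type u}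

instance : AddCommGroup (Double G) := inferInstanceAs (AddCommGroup (G × G →₀ ℂ))

instance : Module ℂ (Double G) := inferInstanceAs (Module ℂ (G × G →₀ ℂ))

/-- The basis element `e_a ⋈ x`. -/
def bas (a x : G) : Double G := Finsupp.single (a, x) 1

/-- The linear map with prescribed values on the basis elements `e_a ⋈ x`. -/
def lin {M : Type*} [AddCommMonoid M] [Module ℂ M] (f : G → G → M) : Double G →ₗ[ℂ] M :=
  Finsupp.linearCombination ℂ (fun p : G × G => f p.1 p.2)

@[simp]
theorem lin_bas {M : Type*} [AddCommMonoid M] [Module ℂ M] (f : G → G → M) (a x : G) :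
    lin f (bas a x) = f a x := by
  refine (Finsupp.linearCombination_single ℂ (1 : ℂ) (a, x)).trans ?_
  simp

theorem hom_ext {M : Type*} [AddCommMonoid M] [Module ℂ M] {f f' : Double G →ₗ[ℂ] M}
    (h : ∀ a x, f (bas a x) = f' (bas a x)) : f = f' := by
  refine Finsupp.lhom_ext' (fun p => LinearMap.ext_ring ?_)
  exact h p.1 p.2

theorem hom_ext₂ {M : Type*} [AddCommMonoid M] [Module ℂ M]
    {f f' : Double G →ₗ[ℂ] Double G →ₗ[ℂ] M}
    (h : ∀ a x b y, f (bas a x) (bas b y) = f' (bas a x) (bas b y)) : f = f' :=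
  hom_ext fun a x => hom_ext fun b y => h a x b y

theorem hom_ext₃ {M : Type*} [AddCommMonoid M] [Module ℂ M]
    {f f' : Double G →ₗ[ℂ] Double G →ₗ[ℂ] Double G →ₗ[ℂ] M}
    (h : ∀ a x b y c w, f (bas a x) (bas b y) (bas c w) = f' (bas a x) (bas b y) (bas c w)) :
    f = f' :=
  hom_ext fun a x => hom_ext₂ fun b y c w => h a x b y c w

end Linear

variable {G : Type u} [Group G]

open Classical in
/-- The multiplication of `D(G)`: `(e_a ⋈ x) (e_b ⋈ y) = δ_{a, x b x⁻¹} (e_a ⋈ x y)`. -/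
def mulHom : Double G →ₗ[ℂ] Double G →ₗ[ℂ] Double G :=
  lin fun a x => lin fun b y => if a = x * b * x⁻¹ then bas a (x * y) else 0

instance : Mul (Double G) := ⟨fun p q => mulHom p q⟩

theorem mul_def (p q : Double G) : p * q = mulHom p q := rfl

open Classical in
theorem bas_mul_bas (a x b y : G) :
    (bas a x * bas b y : Double G) = if a = x * b * x⁻¹ then bas a (x * y) else 0 := by
  simp [mul_def, mulHom]

variable [Fintype G]

/-- The unit of `D(G)` is `∑ a, e_a ⋈ 1`. -/
instance : One (Double G) := ⟨∑ a : G, bas a 1⟩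

theorem one_def : (1 : Double G) = ∑ a : G, bas a 1 := rfl

instance : Ring (Double G) where
  __ := (inferInstance : AddCommGroup (Double G))
  left_distrib p q r := map_add (mulHom p) q r
  right_distrib p q r := by simp [mul_def]
  zero_mul p := by simp [mul_def]
  mul_zero p := by simp [mul_def]
  mul_assoc p q r := by
    have h : mulHom.compr₂ mulHom =
        LinearMap.compl₂ (LinearMap.llcomp ℂ (Double G) (Double G) (Double G) ∘ₗ mulHom)
          mulHom := by
      refine hom_ext₃ fun a x b y c w => ?_
      change mulHom (bas a x * bas b y) (bas c w) = mulHom (bas a x) (bas b y * bas c w)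
      rw [bas_mul_bas, bas_mul_bas]
      by_cases h2 : b = y * c * y⁻¹
      · subst h2
        by_cases h1 : a = x * (y * c * y⁻¹) * x⁻¹
        · subst h1
          simp [mulHom, mul_assoc]
        · rw [if_neg h1, if_pos rfl, map_zero, LinearMap.zero_apply, ← mul_def, bas_mul_bas,
            if_neg h1]
      · rw [if_neg h2]
        by_cases h1 : a = x * b * x⁻¹
        · have h3 : ¬ a = x * y * c * (x * y)⁻¹ := by
            rintro rfl
            apply h2
            have := congrArg (fun t => x⁻¹ * t * x) h1
            simpa [mul_assoc] using this.symm
          rw [if_pos h1, map_zero, ← mul_def, bas_mul_bas, if_neg h3]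
        · simp [if_neg h1]
    exact congrArg (fun f => f p q r) h
  one_mul p := by
    have h : mulHom (1 : Double G) = LinearMap.id := by
      refine hom_ext fun a x => ?_
      classical
      simp [one_def, mulHom, LinearMap.sum_apply]
    exact congrArg (fun f => f p) h
  mul_one p := by
    have h : mulHom.flip (1 : Double G) = LinearMap.id := by
      refine hom_ext fun a x => ?_
      have key (b : G) : a = x * b * x⁻¹ ↔ b = x⁻¹ * a * x := by
        constructor <;> rintro rfl <;> group
      classical
      simp [one_def, mulHom, key]
    exact congrArg (fun f => f p) h

instance : Algebra ℂ (Double G) :=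
  Algebra.ofModule (fun c p q => by simp [mul_def]) (fun c p q => by simp [mul_def])

/-- The coalgebra structure of `D(G)`: the comultiplication is
`Δ(e_a ⋈ x) = ∑_{b c = a} (e_b ⋈ x) ⊗ (e_c ⋈ x)`, and the counit is `ε(e_a ⋈ x) = δ_{a,1}`. -/
instance : CoalgebraStruct ℂ (Double G) where
  comul := lin fun a x => ∑ b : G, bas b x ⊗ₜ[ℂ] bas (b⁻¹ * a) x
  counit := open Classical in lin fun a _ => if a = 1 then 1 else 0

@[simp]
theorem comul_bas (a x : G) : Coalgebra.comul (R := ℂ) (bas a x) =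
    ∑ b : G, bas b x ⊗ₜ[ℂ] bas (b⁻¹ * a) x := lin_bas _ _ _

open Classical in
@[simp]
theorem counit_bas (a x : G) : Coalgebra.counit (R := ℂ) (bas a x) =
    if a = 1 then (1 : ℂ) else 0 := lin_bas _ _ _

instance : Coalgebra ℂ (Double G) where
  coassoc := hom_ext fun a x => by
    classical
    simp [TensorProduct.sum_tmul, TensorProduct.tmul_sum]
    rw [Finset.sum_comm]
    refine Finset.sum_congr rfl fun b _ => ?_
    refine Fintype.sum_equiv (Equiv.mulLeft b⁻¹) _ _ fun c => ?_
    simp [mul_assoc]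
  rTensor_counit_comp_comul := hom_ext fun a x => by
    classical
    simp [TensorProduct.ite_tmul]
  lTensor_counit_comp_comul := hom_ext fun a x => by
    classical
    simp [TensorProduct.tmul_ite]
    simp [inv_mul_eq_one]

instance : Bialgebra ℂ (Double G) where
  counit_one := by
    classical
    simp [one_def]
  mul_compr₂_counit := hom_ext₂ fun a x b y => by
    classical
    simp [bas_mul_bas]
    split_ifs <;> simp_all
  comul_one := by
    classical
    simp [one_def, Algebra.TensorProduct.one_def]
    simp_rw [TensorProduct.sum_tmul, TensorProduct.tmul_sum]
    rw [Finset.sum_comm]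
    refine Finset.sum_congr rfl fun b _ => ?_
    exact Fintype.sum_equiv (Equiv.mulLeft b⁻¹) _ _ fun c => rfl
  mul_compr₂_comul := hom_ext₂ fun a x b y => by
    classical
    simp [bas_mul_bas]
    have key (c e : G) : e = x * c * x⁻¹ ↔ c = x⁻¹ * e * x := by
      constructor <;> rintro rfl <;> group
    simp_rw [key, TensorProduct.ite_tmul]
    rw [Finset.sum_comm]
    simp only [Finset.sum_ite_eq', Finset.mem_univ, if_true]
    have key2 (c : G) : b = x⁻¹ * a * x ↔
        (x⁻¹ * c * x)⁻¹ * b = x⁻¹ * (c⁻¹ * a) * x := by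
      simp only [mul_inv_rev, inv_inv]
      constructor
      · rintro rfl
        group
      · intro h
        have := congrArg (fun t => x⁻¹ * c * x * t) h
        simpa [mul_assoc] using this
    simp_rw [← key2]
    split_ifs <;> simp

/-- The Hopf algebra structure of `D(G)`: the antipode is
`S(e_a ⋈ x) = e_{x⁻¹ a⁻¹ x} ⋈ x⁻¹`. -/
instance : HopfAlgebra ℂ (Double G) where
  antipode := lin fun a x => bas (x⁻¹ * a⁻¹ * x) x⁻¹
  mul_antipode_rTensor_comul := hom_ext fun a x => by
    classical
    simp [bas_mul_bas]
    split_ifs with h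
    · rw [one_def]
      refine Fintype.sum_equiv ((Equiv.inv G).trans (MulAut.conj x⁻¹).toEquiv) _ _ fun c => ?_
      simp
    · rfl
  mul_antipode_lTensor_comul := hom_ext fun a x => by
    classical
    simp [bas_mul_bas]
    have key (c : G) : c = x * (x⁻¹ * (a⁻¹ * c) * x) * x⁻¹ ↔ a = 1 := by
      simp [mul_assoc]
    simp_rw [key]
    split_ifs with h
    · rfl
    · simp

/-- The normalized integral `Λ = |G|⁻¹ ∑ x, e_1 ⋈ x` of `D(G)`. -/
def integral (G : Type u) [Group G] [Fintype G] : Double G :=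
  (Fintype.card G : ℂ)⁻¹ • ∑ x : G, bas 1 x

end Double

/-! ### Higher Frobenius-Schur indicators -/

/-- An element `Λ` of a Hopf algebra is a normalized (two-sided) integral if `ε(Λ) = 1` and
`h Λ = ε(h) Λ = Λ h` for all `h`. -/
structure IsNormalizedIntegral {H : Type*} [Ring H] [HopfAlgebra ℂ H] (Λ : H) : Prop where
  counit_eq_one : Coalgebra.counit (R := ℂ) Λ = 1
  mul_left (h : H) : h * Λ = Coalgebra.counit (R := ℂ) h • Λ
  mul_right (h : H) : Λ * h = Coalgebra.counit (R := ℂ) h • Λ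

/-- A Hopf algebra has at most one normalized integral. -/
theorem IsNormalizedIntegral.unique {H : Type*} [Ring H] [HopfAlgebra ℂ H] {Λ Λ' : H}
    (h : IsNormalizedIntegral Λ) (h' : IsNormalizedIntegral Λ') : Λ = Λ' := by
  have h1 := h.mul_right Λ'
  rw [h'.mul_left Λ, h.counit_eq_one, h'.counit_eq_one, one_smul, one_smul] at h1
  exact h1.symm

theorem Double.integral_isNormalizedIntegral (G : Type u) [Group G] [Fintype G] :
    IsNormalizedIntegral (Double.integral G) where
  counit_eq_one := by
    simp [Double.integral]
  mul_left h := by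
    have key : LinearMap.mulRight ℂ (Double.integral G) =
        (Coalgebra.counit (R := ℂ) (A := Double G)).smulRight (Double.integral G) := by
      refine Double.hom_ext fun a x => ?_
      have e : a = x * 1 * x⁻¹ ↔ a = 1 := by simp
      simp only [LinearMap.mulRight_apply, LinearMap.smulRight_apply, Double.counit_bas,
        Double.integral, mul_smul_comm, Finset.mul_sum, Double.bas_mul_bas]
      by_cases ha : a = 1
      · simp only [if_pos (e.2 ha), if_pos ha, one_smul]
        subst ha
        congr 1
        exact Fintype.sum_equiv (Equiv.mulLeft x) _ _ fun y => rfl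
      · simp [ha]
    exact LinearMap.congr_fun key h
  mul_right h := by
    have key : LinearMap.mulLeft ℂ (Double.integral G) =
        (Coalgebra.counit (R := ℂ) (A := Double G)).smulRight (Double.integral G) := by
      refine Double.hom_ext fun a x => ?_
      have e (y : G) : 1 = y * a * y⁻¹ ↔ a = 1 := by
        rw [eq_comm, conj_eq_one_iff]
      simp only [LinearMap.mulLeft_apply, LinearMap.smulRight_apply, Double.counit_bas,
        Double.integral, smul_mul_assoc, Finset.sum_mul, Double.bas_mul_bas]
      by_cases ha : a = 1
      · simp only [if_pos ((e _).2 ha), if_pos ha, one_smul]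
        congr 1
        exact Fintype.sum_equiv (Equiv.mulRight x) _ _ fun y => rfl
      · simp only [if_neg (mt (e _).1 ha), if_neg ha, zero_smul, Finset.sum_const_zero, smul_zero]
    exact LinearMap.congr_fun key h

/-- The `m`-th Sweedler power `h ↦ h₍₁₎ h₍₂₎ ⋯ h₍ₘ₎`, i.e. the `m`-th power of the identity map in
the convolution algebra `End(H)`. Since the antipode is the inverse of the identity map in the
convolution algebra, for negative `m` it is the `(-m)`-th convolution power of the antipode. -/
def sweedlerPower {H : Type*} [Ring H] [HopfAlgebra ℂ H] : ℤ → H →ₗ[ℂ] H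
  | Int.ofNat n => (WithConv.toConv (LinearMap.id : H →ₗ[ℂ] H) ^ n).ofConv
  | Int.negSucc n => (WithConv.toConv (HopfAlgebra.antipode ℂ (A := H)) ^ (n + 1)).ofConv

/-- The `m`-th Frobenius-Schur indicator `ν_m(M) = χ_M(Λ₍₁₎ Λ₍₂₎ ⋯ Λ₍ₘ₎)` of a module `M` (given by
its structure map `π`) over a Hopf algebra with normalized integral `Λ`. -/
def indicator {H : Type*} [Ring H] [HopfAlgebra ℂ H] (Λ : H) (m : ℤ)
    {M : Type*} [AddCommGroup M] [Module ℂ M] (π : H →ₐ[ℂ] Module.End ℂ M) : ℂ :=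
  LinearMap.trace ℂ M (π (sweedlerPower m Λ))

/-! ### The modules of the double attached to representations of centralizers -/

section Induced

variable {G : Type u} [Group G] (g : G) {V : Type*} [AddCommGroup V] [Module ℂ V]
  (ρ : Representation ℂ (Subgroup.centralizer {g}) V)

/-- The space of the representation of `G` induced from a representation `ρ` of the centralizer
`C_G(g)`: the functions `f : G → V` with `f (t h) = ρ(h)⁻¹ f(t)` for `h ∈ C_G(g)`. -/
def inducedSpace : Submodule ℂ (G → V) where
  carrier := {f | ∀ (t : G) (h : Subgroup.centralizer {g}), f (t * h) = ρ h⁻¹ (f t)}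
  add_mem' := by
    intro f f' hf hf' t h
    simp [hf t h, hf' t h]
  zero_mem' := by
    intro t h
    simp
  smul_mem' := by
    intro c f hf t h
    simp [hf t h]

open Classical in
/-- The action of `e_a ⋈ x` on the induced space: `G` acts by left translation, and `e_a` is the
projection onto the functions supported on `{t | t g t⁻¹ = a}`. -/
def doubleAction (a x : G) : Module.End ℂ (inducedSpace g ρ) where
  toFun f := ⟨fun t => if t * g * t⁻¹ = a then f.1 (x⁻¹ * t) else 0, by
    intro t h
    have hc : (h : G) * g = g * h :=
      (Subgroup.mem_centralizer_singleton_iff.1 h.2)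
    have e : t * h * g * (t * h)⁻¹ = t * g * t⁻¹ := by
      rw [mul_assoc t, hc]
      group
    simp only [e]
    split_ifs
    · rw [← mul_assoc]
      exact f.2 _ h
    · simp⟩
  map_add' f f' := by
    ext t
    by_cases h : t * g * t⁻¹ = a <;> simp [h]
  map_smul' c f := by
    ext t
    by_cases h : t * g * t⁻¹ = a <;> simp [h]

open Classical in
theorem doubleAction_apply (a x : G) (f : inducedSpace g ρ) (t : G) :
    (doubleAction g ρ a x f).1 t = if t * g * t⁻¹ = a then f.1 (x⁻¹ * t) else 0 := rfl

variable [Fintype G]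

/-- The `D(G)`-module associated with `g ∈ G` and a representation `ρ` of `C_G(g)`. -/
def doubleModule : Double G →ₐ[ℂ] Module.End ℂ (inducedSpace g ρ) :=
  AlgHom.ofLinearMap (Double.lin (doubleAction g ρ))
    (by
      classical
      rw [Double.one_def]
      ext f t
      simp [LinearMap.sum_apply, doubleAction_apply])
    (by
      intro p q
      have key : (Double.mulHom (G := G)).compr₂ (Double.lin (doubleAction g ρ)) =
          (LinearMap.mul ℂ (Module.End ℂ (inducedSpace g ρ))).compl₁₂
            (Double.lin (doubleAction g ρ)) (Double.lin (doubleAction g ρ)) := by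
        classical
        refine Double.hom_ext₂ fun a x b y => ?_
        have e (t : G) : x⁻¹ * t * g * (x⁻¹ * t)⁻¹ = b ↔ t * g * t⁻¹ = x * b * x⁻¹ := by
          constructor
          · rintro rfl
            group
          · intro h
            have := congrArg (fun s => x⁻¹ * s * x) h
            simpa [mul_assoc] using this
        ext f t
        simp only [LinearMap.compr₂_apply, LinearMap.compl₁₂_apply, LinearMap.mul_apply',
          Double.lin_bas, ← Double.mul_def, Double.bas_mul_bas, Module.End.mul_apply,
          doubleAction_apply, e]
        by_cases h : a = x * b * x⁻¹
        · subst h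
          by_cases h' : t * g * t⁻¹ = x * b * x⁻¹
          · simp [h', doubleAction_apply, mul_assoc]
          · simp [h', doubleAction_apply]
        · by_cases h' : t * g * t⁻¹ = a
          · have h'' : ¬ t * g * t⁻¹ = x * b * x⁻¹ := fun q => h (h'.symm.trans q)
            simp [h, h'']
          · simp [h, h']
      exact congrArg (fun F => F p q) key)

/-- The `m`-th Frobenius-Schur indicator `ν_m(g, η)` of the `D(G)`-module associated with `g` and
a representation of `C_G(g)` with character `η`. -/
def frobeniusSchur (m : ℤ) : ℂ := indicator (Double.integral G) m (doubleModule g ρ)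

end Induced

/-! ### The functions `γ_m^z`, Adams operators and cyclotomic fields -/

/-- The set `G_m(g,z) = {x | x ^ m = (g x) ^ m = z}`. -/
def rootSet {G : Type u} [Group G] (m : ℤ) (g z : G) : Set G :=
  {x | x ^ m = z ∧ (g * x) ^ m = z}

/-- The function `γ_m^z : C_G(z) → ℂ`, `g ↦ |G_m(g,z)|`. -/
def gamma {G : Type u} [Group G] (m : ℤ) (z : G) : Subgroup.centralizer {z} → ℂ :=
  fun g => ((rootSet m (g : G) z).ncard : ℂ)

/-- The Adams operator `ψ^r(χ)(g) = χ(g ^ r)`. -/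
def adams {H : Type*} [Group H] (r : ℤ) (χ : H → ℂ) : H → ℂ := fun h => χ (h ^ r)

/-- The cyclotomic field `ℚ(ζ_d)` as a subfield of `ℂ`, where `ζ_d = exp(2πi/d)`. -/
def cyclotomicSubfield (d : ℕ) : IntermediateField ℚ ℂ :=
  IntermediateField.adjoin ℚ {Complex.exp (2 * Real.pi * Complex.I / d)}

end DrinfeldIndicator

end

noncomputable section

namespace DrinfeldIndicator

/-! ### Class sums modulo a prime -/

/-! Write G_m(g,z) for `rootSet m g z` and e for exp(G). Evaluating the Sweedler power of the
integral gives ν_m(g,η) = |C_G(g)|⁻¹ ∑_h |G_m(g,h⁻¹)| η(h), a rational class function on C_G(g)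
paired with η (`frobeniusSchur_eq`). The automorphism ζ ↦ ζ^k of ℚ(ζ_e) turns η(h) into η(h^k).
Since irreducible characters separate class functions, Galois theory shows that condition 1 says
|G_m(g,z^k)| = |G_m(g,z)| for all commuting g, z and all k ≡ 1 mod d prime to e
(`forall_frobeniusSchur_mem_iff`).

Condition 2 is the same invariance in the other variable, |G_m(g^k,z)| = |G_m(g,z)|. The bridge is
|G_m(g,z)| = |G_m(g^k,z^k)| for every k prime to e (`ncard_rootSet_pow`).

For the bridge, |G_m(g,z)| is the coefficient of g in a product AB of two conjugation-invariant sums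
in the group algebra of C_G(z). By Dirichlet, k may be replaced by a prime p > |G| congruent to k
mod e. Modulo p, the p-th power is additive up to commutators, so A^p and B^p are the sums of p-th
powers, and the coefficient of g in AB agrees mod p with that of g^p in A^p B^p. Both are counts
below p, hence equal. -/

theorem sum_pow_eq_sum_ofFn_prod {R ι : Type*} [Semiring R] [Fintype ι] (a : ι → R) (n : ℕ) :
    (∑ i, a i) ^ n = ∑ f : Fin n → ι, (List.ofFn fun j => a (f j)).prod := by
  induction n with
  | zero => simp
  | succ n ih =>
    rw [pow_succ', ih, Finset.sum_mul_sum, ← Finset.sum_product',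
      ← (Fin.consEquiv fun _ => ι).sum_comp]
    refine Finset.sum_congr (by ext; simp) fun x _ => ?_
    simp [Fin.consEquiv, List.ofFn_succ]

/-- In characteristic `p`, a sum which is invariant under a permutation of order dividing `p` may be
restricted to the fixed points. -/
theorem sum_eq_sum_fixedPoints {X k : Type*} [Fintype X] [DecidableEq X] [Ring k] (p : ℕ)
    [hp : Fact p.Prime] [CharP k p] (σ : Equiv.Perm X) (hσ : σ ^ p = 1) (F : X → k)
    (hF : ∀ x, F (σ x) = F x) :
    ∑ x, F x = ∑ x with σ x = x, F x := by
  classical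
  -- The sum is split by the value v of F; on each fibre it remains to compare the number of points
  -- with the number of fixed points mod p.
  rw [← Finset.sum_fiberwise_of_maps_to (t := Finset.univ.image F) (g := F) (by simp) F,
    ← Finset.sum_fiberwise_of_maps_to (s := Finset.univ.filter fun x => σ x = x)
      (t := Finset.univ.image F) (g := F) (by simp) F]
  refine Finset.sum_congr rfl fun v _ => ?_
  have e (s : Finset X) : ∑ x ∈ s with F x = v, F x =
      ((s.filter fun x => F x = v).card : k) * v := by
    rw [Finset.sum_congr rfl fun x hx => (Finset.mem_filter.1 hx).2, Finset.sum_const, nsmul_eq_mul]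
  rw [e, e]
  congr 1
  let τ : Equiv.Perm {x // F x = v} := σ.subtypePerm fun x => by rw [hF]
  have hτ : τ ^ p ^ 1 = 1 := by
    ext x
    simp [τ, Equiv.Perm.subtypePerm_pow, hσ]
  have h := (CharP.cast_eq_iff_mod_eq k p).2 (Equiv.Perm.card_compl_support_modEq hτ)
  rw [Fintype.card_subtype] at h
  rw [← h]
  congr 1
  refine Finset.card_bij (fun x _ => x.1) ?_ ?_ ?_
  · intro x hx
    have : τ x = x := by simpa using hx
    exact Finset.mem_filter.2 ⟨Finset.mem_filter.2 ⟨Finset.mem_univ _, congrArg Subtype.val this⟩, x.2⟩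
  · intro x _ y _ h
    exact Subtype.ext h
  · intro x hx
    have hx' := (Finset.mem_filter.1 hx)
    refine ⟨⟨x, hx'.2⟩, ?_, rfl⟩
    simpa [τ, Subtype.ext_iff] using hx'.1

/-- In characteristic `p`, the Frobenius map is additive under a trace. -/
theorem map_sum_pow_char {R k ι : Type*} [Semiring R] [Ring k] [Fintype ι] (p : ℕ)
    [hp : Fact p.Prime] [CharP k p] (T : R →+ k) (hT : ∀ x y, T (x * y) = T (y * x))
    (a : ι → R) : T ((∑ i, a i) ^ p) = ∑ i, T (a i ^ p) := by
  classical
  obtain ⟨n, rfl⟩ : ∃ n, p = n + 2 := ⟨p - 2, by have := hp.out.two_le; omega⟩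
  have hrot : finRotate (n + 2) ^ (n + 2) = 1 := by
    have h := (isCycle_finRotate (n := n)).orderOf
    rw [support_finRotate, Finset.card_univ, Fintype.card_fin] at h
    exact orderOf_dvd_iff_pow_eq_one.1 h.dvd
  -- Cyclic shift of words of length p. The trace of a product is unchanged by it, and its fixed
  -- words are the constant ones, which contribute the terms a i ^ p.
  let σ : Equiv.Perm (Fin (n + 2) → ι) := (finRotate (n + 2)).symm.arrowCongr (Equiv.refl ι)
  have hσa (f : Fin (n + 2) → ι) (i) : σ f i = f (i + 1) := by
    simp [σ, Equiv.arrowCongr]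
  have hσp (m : ℕ) (f : Fin (n + 2) → ι) : (σ ^ m) f = f ∘ (finRotate (n + 2) ^ m) := by
    induction m with
    | zero => rfl
    | succ m ih =>
      rw [pow_succ', Equiv.Perm.mul_apply, ih]
      ext i
      rw [hσa, pow_succ]
      simp
  rw [sum_pow_eq_sum_ofFn_prod, map_sum, sum_eq_sum_fixedPoints (n + 2) σ]
  · refine (Finset.sum_bij (fun i _ => fun _ => i) ?_ ?_ ?_ ?_).symm
    · intro i _
      simp only [Finset.mem_filter_univ]
      ext j
      rw [hσa]
    · intro i _ j _ h
      exact congrFun h 0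
    · intro f hf
      have hf' : σ f = f := (Finset.mem_filter.1 hf).2
      refine ⟨f 0, Finset.mem_univ _, ?_⟩
      ext j
      induction j using Fin.induction with
      | zero => rfl
      | succ j ih =>
        have := congrFun hf' j.castSucc
        rw [hσa, Fin.coeSucc_eq_succ] at this
        rw [this, ← ih]
    · intro i _
      rw [List.ofFn_const, List.prod_replicate]
  · ext f : 1
    rw [hσp, hrot]
    rfl
  · intro f
    rw [List.ofFn_succ (f := fun j => a (f j)), List.prod_cons, hT, List.ofFn_succ_last,
      List.prod_append]
    simp only [hσa, Fin.coeSucc_eq_succ, Fin.last_add_one, List.prod_singleton]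

/-- The functional `x ↦ ∑ u, x (u g u⁻¹)` on a group algebra. -/
def conjSum {H : Type*} [Group H] [Fintype H] (k : Type*) [CommRing k] (g : H) :
    MonoidAlgebra k H →+ k where
  toFun x := ∑ u : H, x.coeff (u * g * u⁻¹)
  map_zero' := by simp
  map_add' x y := by simp [Finset.sum_add_distrib]

open Classical in
theorem conjSum_single {H : Type*} [Group H] [Fintype H] (k : Type*) [CommRing k] (g a : H)
    (c : k) : conjSum k g (MonoidAlgebra.single a c) = ∑ u : H, if u * g * u⁻¹ = a then c else 0 := by
  refine Finset.sum_congr rfl fun u _ => ?_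
  rw [MonoidAlgebra.coeff_single, Finsupp.single_apply]
  simp only [eq_comm]

/-- The products ab and ba are conjugate by a; the substitution u ↦ a⁻¹u matches the two sums. -/
theorem conjSum_mul_comm {H : Type*} [Group H] [Fintype H] (k : Type*) [CommRing k] (g : H)
    (x y : MonoidAlgebra k H) : conjSum k g (x * y) = conjSum k g (y * x) := by
  classical
  induction x using MonoidAlgebra.induction_linear with
  | zero => simp
  | add x x' hx hx' => rw [add_mul, mul_add, map_add, map_add, hx, hx']
  | single a c =>
    induction y using MonoidAlgebra.induction_linear with
    | zero => simp
    | add x x' hx hx' => rw [add_mul, mul_add, map_add, map_add, hx, hx']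
    | single b c' =>
      rw [MonoidAlgebra.single_mul_single, MonoidAlgebra.single_mul_single, conjSum_single,
        conjSum_single, mul_comm c]
      refine Fintype.sum_equiv (Equiv.mulLeft a⁻¹) _ _ fun u => ?_
      congr 1
      rw [Equiv.coe_mulLeft, eq_iff_iff]
      constructor
      · intro h
        calc a⁻¹ * u * g * (a⁻¹ * u)⁻¹ = a⁻¹ * (u * g * u⁻¹) * a := by group
          _ = b * a := by rw [h]; group
      · intro h
        calc u * g * u⁻¹ = a * (a⁻¹ * u * g * (a⁻¹ * u)⁻¹) * a⁻¹ := by group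
          _ = a * b := by rw [h]; group

/-- Coefficients of a central element are constant on classes. When |H| is invertible in k, the
trace `conjSum` therefore recovers them. -/
theorem conjSum_of_conj_invariant {H : Type*} [Group H] [Fintype H] (k : Type*) [CommRing k] (g : H)
    (x : MonoidAlgebra k H) (hx : ∀ u, Commute (MonoidAlgebra.single u 1) x) :
    conjSum k g x = Fintype.card H * x.coeff g := by
  rw [← nsmul_eq_mul, ← Finset.card_univ, ← Finset.sum_const]
  refine Finset.sum_congr rfl fun u _ => ?_
  have := congrArg (fun y => y.coeff (u * g)) (hx u).eq
  simpa [MonoidAlgebra.coeff_single_mul_apply, MonoidAlgebra.coeff_mul_single_apply] using this.symm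

/-- The sum of the elements of a finite set in the group algebra. -/
def setSum {H : Type*} (k : Type*) [CommRing k] (A : Finset H) : MonoidAlgebra k H :=
  ∑ a ∈ A, MonoidAlgebra.single a 1

open Classical in
theorem coeff_setSum {H : Type*} (k : Type*) [CommRing k] (A : Finset H) (h : H) :
    (setSum k A).coeff h = if h ∈ A then 1 else 0 := by
  simp [setSum, MonoidAlgebra.coeff_sum, MonoidAlgebra.coeff_single, Finsupp.single_apply]

theorem coeff_setSum_mul_setSum {H : Type*} [Group H] (k : Type*) [CommRing k] (A B : Finset H)
    (h : H) [DecidablePred fun b => h * b⁻¹ ∈ A] :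
    (setSum k A * setSum k B).coeff h = ((B.filter fun b => h * b⁻¹ ∈ A).card : k) := by
  rw [setSum.eq_def k B, Finset.mul_sum, MonoidAlgebra.coeff_sum, Finsupp.finsetSum_apply]
  simp only [MonoidAlgebra.coeff_mul_single_apply, coeff_setSum, mul_one]
  rw [Finset.natCast_card_filter]
  exact Finset.sum_congr rfl fun b _ => by congr

theorem commute_single_setSum {H : Type*} [Group H] (k : Type*) [CommRing k] {A : Finset H}
    (hA : ∀ u, ∀ a ∈ A, u * a * u⁻¹ ∈ A) (u : H) :
    Commute (MonoidAlgebra.single u 1) (setSum k A) := by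
  classical
  ext h
  rw [MonoidAlgebra.coeff_single_mul_apply, MonoidAlgebra.coeff_mul_single_apply, coeff_setSum,
    coeff_setSum, one_mul, mul_one]
  congr 1
  rw [eq_iff_iff]
  constructor <;> intro hh
  · simpa [mul_assoc] using hA u _ hh
  · simpa [mul_assoc] using hA u⁻¹ _ hh

theorem commute_setSum {H : Type*} [Group H] (k : Type*) [CommRing k] {A : Finset H}
    (hA : ∀ u, ∀ a ∈ A, u * a * u⁻¹ ∈ A) (B : Finset H) :
    Commute (setSum k A) (setSum k B) :=
  Commute.sum_right _ _ _ fun u _ => (commute_single_setSum k hA u).symm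

section PrimePower

variable {H : Type*} [Group H] [Fintype H] (p : ℕ) [hp : Fact p.Prime]

/-- Both sides are central, so it suffices to compare them under `conjSum` at each g and cancel |H|.
There the p-th power passes through the sum, and a ↦ a^p is a bijection from A to B because p is
prime to |H|. -/
theorem setSum_pow_prime (hpH : ¬ p ∣ Fintype.card H) {A B : Finset H}
    (hA : ∀ u, ∀ a ∈ A, u * a * u⁻¹ ∈ A) (hB : ∀ u, ∀ a ∈ B, u * a * u⁻¹ ∈ B)
    (hAB : ∀ a, a ∈ A ↔ a ^ p ∈ B) :
    setSum (ZMod p) A ^ p = setSum (ZMod p) B := by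
  classical
  have hcop : (Nat.card H).Coprime p :=
    ((Nat.Prime.coprime_iff_not_dvd hp.out).2 (by rwa [Nat.card_eq_fintype_card])).symm
  have hBA : setSum (ZMod p) B = ∑ a : A, MonoidAlgebra.single (a.1 ^ p) 1 := by
    rw [Finset.sum_coe_sort A fun a => MonoidAlgebra.single (a ^ p) (1 : ZMod p), setSum]
    refine (Finset.sum_bij (fun a _ => a ^ p) ?_ ?_ ?_ ?_).symm
    · exact fun a ha => (hAB a).1 ha
    · exact fun a _ b _ h => (powCoprime hcop).injective h
    · intro b hb
      obtain ⟨a, rfl⟩ := (powCoprime hcop).surjective b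
      exact ⟨a, (hAB a).2 hb, rfl⟩
    · exact fun _ _ => rfl
  have hne : (Fintype.card H : ZMod p) ≠ 0 := by
    rwa [Ne, ZMod.natCast_eq_zero_iff]
  ext g
  refine mul_left_cancel₀ hne ?_
  rw [← conjSum_of_conj_invariant _ _ _ fun u => (commute_single_setSum _ hA u).pow_right p,
    ← conjSum_of_conj_invariant _ _ _ fun u => commute_single_setSum _ hB u, hBA, map_sum, setSum,
    ← Finset.sum_coe_sort A fun a => MonoidAlgebra.single a (1 : ZMod p),
    map_sum_pow_char p _ (conjSum_mul_comm _ g)]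
  simp [MonoidAlgebra.single_pow]

/-- The structure constants of the class algebra are invariant under `p`-th powers, for every
prime `p` exceeding the order of the group. -/
theorem card_structure_constant_pow_prime (hpH : Fintype.card H < p) {A B A' B' : Finset H}
    (hA : ∀ u, ∀ a ∈ A, u * a * u⁻¹ ∈ A) (hB : ∀ u, ∀ a ∈ B, u * a * u⁻¹ ∈ B)
    (hA' : ∀ u, ∀ a ∈ A', u * a * u⁻¹ ∈ A') (hB' : ∀ u, ∀ a ∈ B', u * a * u⁻¹ ∈ B')
    (hAA' : ∀ a, a ∈ A ↔ a ^ p ∈ A') (hBB' : ∀ a, a ∈ B ↔ a ^ p ∈ B') (h : H)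
    [DecidablePred fun b => h * b⁻¹ ∈ A] [DecidablePred fun b => h ^ p * b⁻¹ ∈ A'] :
    (B.filter fun b => h * b⁻¹ ∈ A).card = (B'.filter fun b => h ^ p * b⁻¹ ∈ A').card := by
  have hpd : ¬ p ∣ Fintype.card H := fun hd => absurd (Nat.le_of_dvd Fintype.card_pos hd) hpH.not_ge
  have hcop : (Nat.card H).Coprime p :=
    ((Nat.Prime.coprime_iff_not_dvd hp.out).2 (by rwa [Nat.card_eq_fintype_card])).symm
  have hne : (Fintype.card H : ZMod p) ≠ 0 := by
    rwa [Ne, ZMod.natCast_eq_zero_iff]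
  have hlt (s : Finset H) : s.card < p := (Finset.card_le_univ s).trans_lt hpH
  suffices hz : (((B.filter fun b => h * b⁻¹ ∈ A).card : ℕ) : ZMod p) =
      ((B'.filter fun b => h ^ p * b⁻¹ ∈ A').card : ℕ) by
    rw [ZMod.natCast_eq_natCast_iff] at hz
    exact Nat.ModEq.eq_of_lt_of_lt hz (hlt _) (hlt _)
  refine mul_left_cancel₀ hne ?_
  have c1 (u) := (commute_single_setSum (ZMod p) hA u).mul_right (commute_single_setSum _ hB u)
  have c2 (u) := (commute_single_setSum (ZMod p) hA' u).mul_right (commute_single_setSum _ hB' u)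
  rw [← coeff_setSum_mul_setSum, ← coeff_setSum_mul_setSum]
  rw [← conjSum_of_conj_invariant _ _ _ c1, ← conjSum_of_conj_invariant _ _ _ c2,
    ← setSum_pow_prime p hpd hA hA' hAA', ← setSum_pow_prime p hpd hB hB' hBB',
    ← (commute_setSum _ hA B).mul_pow]
  have e3 : setSum (ZMod p) A * setSum (ZMod p) B =
      ∑ x : A × B, MonoidAlgebra.single (x.1.1 * x.2.1) 1 := by
    rw [setSum, setSum, Finset.sum_mul_sum, Fintype.sum_prod_type,
      ← Finset.sum_coe_sort A]
    refine Finset.sum_congr rfl fun a _ => ?_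
    rw [← Finset.sum_coe_sort B]
    simp [MonoidAlgebra.single_mul_single]
  -- The power (AB)^p is expanded as a sum of (ab)^p under the trace at h^p. Taking p-th powers is
  -- injective, so (ab)^p is conjugate to h^p by u exactly when ab is conjugate to h by u.
  rw [e3, map_sum_pow_char p _ (conjSum_mul_comm _ _), map_sum]
  refine Finset.sum_congr rfl fun x _ => ?_
  rw [MonoidAlgebra.single_pow, conjSum_single, conjSum_single, one_pow]
  refine Finset.sum_congr rfl fun u _ => ?_
  congr 1
  rw [eq_iff_iff, ← conj_pow]
  exact (powCoprime hcop).injective.eq_iff.symm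

end PrimePower

/-! ### Root sets as structure constants -/

open Classical in
-- With b = x⁻¹, an element x of the root set is a factorization g = ab in which a and b⁻¹ are m-th
-- roots of z.
theorem ncard_rootSet {G : Type u} [Group G] {H : Subgroup G} [Fintype H] (m : ℤ) (g : H) (z : G)
    (hz : ∀ x : G, x ^ m = z → x ∈ H) :
    (rootSet m (g : G) z).ncard =
      ((Finset.univ.filter fun b : H => ((b⁻¹ : H) : G) ^ m = z).filter fun b =>
        g * b⁻¹ ∈ Finset.univ.filter fun a : H => (a : G) ^ m = z).card := by
  rw [← Set.ncard_coe_finset]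
  refine (Set.ncard_congr (fun b _ => ((b⁻¹ : H) : G)) ?_ ?_ ?_).symm
  · intro b hb
    simpa [rootSet] using hb
  · intro b c _ _ h
    exact inv_injective (Subtype.ext h)
  · intro x hx
    refine ⟨⟨x, hz x hx.1⟩⁻¹, ?_, by simp⟩
    simpa [rootSet] using hx

theorem ncard_rootSet_pow_prime {G : Type u} [Group G] [Fintype G] (m : ℤ) (p : ℕ)
    [hp : Fact p.Prime] (hpG : Fintype.card G < p) {z g : G} (hg : Commute g z) :
    (rootSet m g z).ncard = (rootSet m (g ^ p) (z ^ p)).ncard := by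
  classical
  have hcop : (Nat.card G).Coprime p :=
    ((Nat.Prime.coprime_iff_not_dvd hp.out).2 fun hd => by
      rw [Nat.card_eq_fintype_card] at hd
      exact absurd (Nat.le_of_dvd Fintype.card_pos hd) hpG.not_ge).symm
  let H : Subgroup G := Subgroup.centralizer {z}
  have hH (x : G) : x ∈ H ↔ x * z = z * x := Subgroup.mem_centralizer_singleton_iff
  have h1 (x : G) (hx : x ^ m = z) : x ∈ H := by
    rw [hH, ← hx]
    exact ((Commute.refl x).zpow_right m).eq
  have h2 (x : G) (hx : x ^ m = z ^ p) : x ∈ H := by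
    -- An m-th root of z^p also centralizes z: conjugation by x fixes z^p, and p-th powers are
    -- injective. So the same subgroup H serves z and z^p.
    have hc : Commute x (z ^ p) := hx ▸ (Commute.refl x).zpow_right m
    rw [hH, ← mul_inv_eq_iff_eq_mul]
    refine (powCoprime hcop).injective ?_
    change (x * z * x⁻¹) ^ p = z ^ p
    rw [conj_pow, hc.eq, mul_inv_cancel_right]
  have hconj (u a : H) (w : G) (hw : Commute (u : G) w) (ha : (a : G) ^ m = w) :
      ((u * a * u⁻¹ : H) : G) ^ m = w := by
    rw [Subgroup.coe_mul, Subgroup.coe_mul, Subgroup.coe_inv, conj_zpow, ha, hw.eq,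
      mul_inv_cancel_right]
  have hcz (u : H) : Commute (u : G) z := (hH u).1 u.2
  have hpow (a : H) : (a : G) ^ m = z ↔ ((a ^ p : H) : G) ^ m = z ^ p := by
    rw [Subgroup.coe_pow, ← zpow_natCast, ← zpow_mul, mul_comm, zpow_mul, zpow_natCast]
    exact (powCoprime hcop).injective.eq_iff.symm
  have hgH : g ∈ H := (hH g).2 hg.eq
  have e1 := ncard_rootSet m (⟨g, hgH⟩ : H) z h1
  have e2 := ncard_rootSet m (⟨g, hgH⟩ ^ p : H) (z ^ p) h2
  rw [Subgroup.coe_pow] at e2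
  rw [e1, e2]
  have hinv (u a : H) : (u * a * u⁻¹)⁻¹ = u * a⁻¹ * u⁻¹ := by group
  refine card_structure_constant_pow_prime p
    ((Fintype.card_le_of_injective _ H.subtype_injective).trans_lt hpG) ?_ ?_ ?_ ?_ ?_ ?_ _ <;>
    simp only [Finset.mem_filter_univ]
  · exact fun u a ha => hconj u a z (hcz u) ha
  · intro u a ha
    rw [hinv]
    exact hconj u a⁻¹ z (hcz u) ha
  · exact fun u a ha => hconj u a _ ((hcz u).pow_right p) ha
  · intro u a ha
    rw [hinv]
    exact hconj u a⁻¹ _ ((hcz u).pow_right p) ha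
  · exact hpow
  · intro a
    rw [hpow, inv_pow]

/-- `γ_m^z(g) = γ_m^{z^k}(g^k)` for `k` coprime to the exponent. -/
theorem ncard_rootSet_pow {G : Type u} [Group G] [Fintype G] (m : ℤ) (k : ℕ)
    (hk : k.Coprime (Monoid.exponent G)) {z g : G} (hg : Commute g z) :
    (rootSet m g z).ncard = (rootSet m (g ^ k) (z ^ k)).ncard := by
  obtain ⟨p, hpG, hp, hpk⟩ := Nat.forall_exists_prime_gt_and_modEq (Fintype.card G)
    Monoid.exponent_ne_zero_of_finite hk
  have := Fact.mk hp
  have e (x : G) : x ^ p = x ^ k :=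
    pow_eq_pow_iff_modEq.2 (hpk.of_dvd (Monoid.order_dvd_exponent x))
  rw [ncard_rootSet_pow_prime m p hpG hg, e, e]

/-! ### Sweedler powers and indicators of the Drinfeld double -/

section Sweedler

variable {G : Type u} [Group G] [Fintype G]

open Double

open Classical in
-- The iterated coproduct runs over c = b₁⋯bₙ, and the product of the e_{bᵢ} ⋈ x vanishes unless
-- bᵢ₊₁ = x⁻¹bᵢx. With a = b₁ the surviving condition is c = (ax⁻¹)ⁿxⁿ.
theorem sweedlerPower_natCast_bas (n : ℕ) (c x : G) :
    sweedlerPower (n : ℤ) (bas c x) =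
      ∑ a : G, if (a * x⁻¹) ^ n * x ^ n = c then bas a (x ^ n) else 0 := by
  change (WithConv.toConv (LinearMap.id : Double G →ₗ[ℂ] Double G) ^ n) (bas c x) = _
  induction n generalizing c with
  | zero =>
    rw [pow_zero, LinearMap.convOne_apply, counit_bas]
    simp only [pow_zero, mul_one, eq_comm (a := (1 : G))]
    split_ifs <;> simp [one_def]
  | succ n ih =>
    rw [pow_succ', LinearMap.convMul_apply, comul_bas, map_sum, map_sum]
    refine Finset.sum_congr rfl fun b _ => ?_
    rw [TensorProduct.map_tmul, LinearMap.mul'_apply]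
    change bas b x * (WithConv.toConv (LinearMap.id : Double G →ₗ[ℂ] Double G) ^ n)
      (bas (b⁻¹ * c) x) = _
    rw [ih, Finset.mul_sum, Finset.sum_eq_single (x⁻¹ * b * x)]
    · have e : (x⁻¹ * b * x * x⁻¹) ^ n * x ^ n = b⁻¹ * c ↔
          (b * x⁻¹) ^ (n + 1) * x ^ (n + 1) = c := by
        have e1 : (x⁻¹ * b * x * x⁻¹) = x⁻¹ * (b * x⁻¹) * x⁻¹⁻¹ := by group
        rw [e1, conj_pow, eq_inv_mul_iff_mul_eq, pow_succ', pow_succ']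
        simp only [mul_assoc, inv_inv]
      simp only [e, mul_ite, mul_zero, bas_mul_bas, ← pow_succ']
      congr 1
      rw [if_pos (by group)]
    · intro a _ ha
      have hne : b ≠ x * a * x⁻¹ := by
        rintro rfl
        exact ha (by group)
      rw [mul_ite, mul_zero, bas_mul_bas, if_neg hne, ite_self]
    · simp

open Classical in
theorem sweedlerPower_neg_bas (n : ℕ) (c x : G) :
    (WithConv.toConv (HopfAlgebra.antipode ℂ (A := Double G)) ^ n) (bas c x) =
      ∑ a : G, if x ^ n * (a * x⁻¹) ^ n = c⁻¹ then bas a (x⁻¹ ^ n) else 0 := by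
  induction n generalizing c with
  | zero =>
    rw [pow_zero, LinearMap.convOne_apply, counit_bas]
    simp only [pow_zero, mul_one, eq_comm (a := (1 : G)), inv_eq_one]
    split_ifs <;> simp [one_def]
  | succ n ih =>
    rw [pow_succ', LinearMap.convMul_apply, comul_bas, map_sum, map_sum]
    -- The index a = x⁻¹b⁻¹x is that of the leading factor S(e_b ⋈ x).
    refine Fintype.sum_equiv ((Equiv.inv G).trans (MulAut.conj x⁻¹).toEquiv) _ _ fun b => ?_
    rw [TensorProduct.map_tmul, LinearMap.mul'_apply]
    change (HopfAlgebra.antipode ℂ (A := Double G)) (bas b x) *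
      (WithConv.toConv (HopfAlgebra.antipode ℂ (A := Double G)) ^ n) (bas (b⁻¹ * c) x) = _
    have hS : HopfAlgebra.antipode ℂ (bas b x) = bas (x⁻¹ * b⁻¹ * x) x⁻¹ := lin_bas _ _ _
    have hc : ((Equiv.inv G).trans (MulAut.conj x⁻¹).toEquiv) b = x⁻¹ * b⁻¹ * x := by simp
    rw [ih, Finset.mul_sum, Finset.sum_eq_single b⁻¹, hc]
    · have e : x ^ n * (b⁻¹ * x⁻¹) ^ n = (b⁻¹ * c)⁻¹ ↔
          x ^ (n + 1) * (x⁻¹ * b⁻¹ * x * x⁻¹) ^ (n + 1) = c⁻¹ := by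
        have e1 : (x⁻¹ * b⁻¹ * x * x⁻¹) = x⁻¹ * (b⁻¹ * x⁻¹) * x⁻¹⁻¹ := by group
        rw [e1, conj_pow, mul_inv_rev, inv_inv, eq_comm, ← eq_mul_inv_iff_mul_eq, eq_comm,
          pow_succ x, pow_succ (b⁻¹ * x⁻¹)]
        simp only [mul_assoc, inv_inv, mul_inv_cancel_left, inv_mul_cancel, mul_one]
      simp only [e, mul_ite, mul_zero, hS, bas_mul_bas, ← pow_succ']
      congr 1
      rw [if_pos (by group)]
    · intro a _ ha
      have hne : x⁻¹ * b⁻¹ * x ≠ x⁻¹ * a * x⁻¹⁻¹ := by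
        intro h
        have := congrArg (fun t => x * t * x⁻¹) h
        exact ha (by simpa [mul_assoc] using this.symm)
      rw [mul_ite, mul_zero, hS, bas_mul_bas, if_neg hne, ite_self]
    · simp

open Classical in
-- Substituting y = x⁻¹ makes the formulas for m ≥ 0 and m ≤ 0 coincide.
theorem sweedlerPower_integral (m : ℤ) :
    sweedlerPower m (integral G) = (Fintype.card G : ℂ)⁻¹ •
      ∑ y : G, ∑ a : G, if (a * y) ^ m = y ^ m then bas a (y ^ (-m)) else 0 := by
  rw [integral, map_smul, map_sum]
  congr 1
  refine Fintype.sum_equiv (Equiv.inv G) _ _ fun x => ?_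
  rw [Equiv.inv_apply]
  obtain ⟨n, rfl | rfl⟩ := m.eq_nat_or_neg
  · rw [sweedlerPower_natCast_bas]
    simp [mul_eq_one_iff_eq_inv]
  · have h : sweedlerPower (-(n : ℤ)) (bas 1 x) =
        (WithConv.toConv (HopfAlgebra.antipode ℂ (A := Double G)) ^ n) (bas 1 x) := by
      cases n with
      | zero => rfl
      | succ n => rfl
    rw [h, sweedlerPower_neg_bas]
    simp [mul_eq_one_iff_eq_inv, eq_comm]

end Sweedler

/-! ### Traces on the induced modules -/

section Trace

variable {G : Type u} [Group G] (g : G) {V : Type*} [AddCommGroup V] [Module ℂ V]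
  (ρ : Representation ℂ (Subgroup.centralizer {g}) V)

theorem out_inv_mul_mem (t : G) : t⁻¹ * (QuotientGroup.mk (s := Subgroup.centralizer {g}) t).out ∈
    Subgroup.centralizer {g} :=
  QuotientGroup.eq.1 (QuotientGroup.out_eq' _).symm

/-- A function in the induced space is determined by its values on coset representatives. -/
def inducedSpaceEquiv : inducedSpace g ρ ≃ₗ[ℂ] (G ⧸ Subgroup.centralizer {g} → V) where
  toFun f q := f.1 q.out
  map_add' _ _ := rfl
  map_smul' _ _ := rfl
  invFun φ := ⟨fun t => ρ ⟨_, out_inv_mul_mem g t⟩ (φ t), by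
    intro t h
    rw [← Module.End.mul_apply, ← map_mul]
    have e : ((t * h : G) : G ⧸ Subgroup.centralizer {g}) = t :=
      QuotientGroup.mk_mul_of_mem t h.2
    simp only [e]
    congr 2
    ext
    simp [mul_assoc]⟩
  left_inv f := by
    ext t
    have := f.2 ((t : G ⧸ Subgroup.centralizer {g}).out) ⟨_, out_inv_mul_mem g t⟩⁻¹
    rw [inv_inv] at this
    simpa using this.symm
  right_inv φ := by
    ext q
    have e : (q.out : G ⧸ Subgroup.centralizer {g}) = q := QuotientGroup.out_eq' q
    have e' : (⟨_, out_inv_mul_mem g q.out⟩ : Subgroup.centralizer {g}) = 1 := by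
      ext
      simp [e]
    simp only [e']
    simp [e]

theorem trace_compLeft {ι : Type*} [Fintype ι] [FiniteDimensional ℂ V] (S : Module.End ℂ V) :
    LinearMap.trace ℂ (ι → V) (S.compLeft ι) = Fintype.card ι * LinearMap.trace ℂ V S := by
  classical
  let b := Module.finBasis ℂ V
  rw [LinearMap.trace_eq_matrix_trace ℂ (Pi.basis fun _ : ι => b),
    LinearMap.trace_eq_matrix_trace ℂ b, Matrix.trace, Fintype.sum_sigma, Matrix.trace,
    ← nsmul_eq_mul, ← Finset.card_univ, ← Finset.sum_const]
  refine Finset.sum_congr rfl fun i _ => Finset.sum_congr rfl fun j _ => ?_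
  simp [LinearMap.toMatrix_apply]

theorem trace_of_pointwise [Fintype G] [FiniteDimensional ℂ V] (S : Module.End ℂ V)
    (T : Module.End ℂ (inducedSpace g ρ)) (hT : ∀ f t, (T f).1 t = S (f.1 t)) :
    LinearMap.trace ℂ _ T =
      (Nat.card (G ⧸ Subgroup.centralizer {g}) : ℂ) * LinearMap.trace ℂ V S := by
  classical
  rw [← LinearMap.trace_conj' T (inducedSpaceEquiv g ρ), Nat.card_eq_fintype_card,
    ← trace_compLeft]
  congr 1
  refine LinearMap.ext fun φ => funext fun q => ?_
  obtain ⟨f, rfl⟩ := (inducedSpaceEquiv g ρ).surjective φ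
  rw [LinearEquiv.conj_apply_apply, LinearEquiv.symm_apply_apply]
  exact hT f _

open Classical in
-- At the point t only a = tgt⁻¹ contributes. After the substitution y = txt⁻¹ the value f(y^m t) =
-- f(t x^m) equals ρ(x^(-m)) f(t), so the Sweedler power acts by one operator S at every t, and its
-- trace is [G : C_G(g)] tr S.
theorem frobeniusSchur_eq [Fintype G] [FiniteDimensional ℂ V] (m : ℤ) :
    frobeniusSchur g ρ m = (Nat.card (Subgroup.centralizer {g}) : ℂ)⁻¹ *
      ∑ h : Subgroup.centralizer {g}, ((rootSet m g (h : G)⁻¹).ncard : ℂ) * ρ.character h := by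
  classical
  have hcomm (x : G) (hx : (g * x) ^ m = x ^ m) : x ^ (-m) ∈ Subgroup.centralizer {g} := by
    rw [zpow_neg, Subgroup.inv_mem_iff, Subgroup.mem_centralizer_singleton_iff]
    have h1 : Commute (g * x) (x ^ m) := hx ▸ (Commute.refl (g * x)).zpow_right m
    have h2 : Commute (x⁻¹) (x ^ m) := ((Commute.refl x).zpow_right m).inv_left
    simpa using (h1.mul_left h2).eq.symm
  let S : Module.End ℂ V := (Fintype.card G : ℂ)⁻¹ •
    ∑ h : Subgroup.centralizer {g}, ((rootSet m g (h : G)⁻¹).ncard : ℂ) • ρ h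
  have hS (v : V) : S v = (Fintype.card G : ℂ)⁻¹ •
      ∑ x : G, if hx : (g * x) ^ m = x ^ m then ρ ⟨_, hcomm x hx⟩ v else 0 := by
    have e (h : Subgroup.centralizer {g}) : ((rootSet m g (h : G)⁻¹).ncard : ℂ) • ρ h v =
        ∑ x : G, if x ^ m = (h : G)⁻¹ ∧ (g * x) ^ m = (h : G)⁻¹ then ρ h v else 0 := by
      rw [Set.ncard_eq_toFinset_card', ← Finset.sum_filter, Finset.sum_const, Nat.cast_smul_eq_nsmul]
      congr 2
      ext x
      rw [Finset.mem_filter_univ]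
      exact Set.mem_toFinset
    simp only [S, LinearMap.smul_apply, LinearMap.sum_apply, e]
    rw [Finset.sum_comm]
    congr 1
    refine Finset.sum_congr rfl fun x _ => ?_
    split_ifs with hx
    · rw [Finset.sum_eq_single ⟨_, hcomm x hx⟩]
      · simp [hx]
      · intro h _ hne
        rw [if_neg]
        rintro ⟨h1, -⟩
        apply hne
        ext
        simp [h1]
      · simp
    · refine Finset.sum_eq_zero fun h _ => if_neg ?_
      rintro ⟨h1, h2⟩
      exact hx (h2.trans h1.symm)
  rw [frobeniusSchur, indicator, trace_of_pointwise g ρ S]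
  · have hG : (Nat.card (G ⧸ Subgroup.centralizer {g}) : ℂ) * (Fintype.card G : ℂ)⁻¹ =
        (Nat.card (Subgroup.centralizer {g}) : ℂ)⁻¹ := by
      rw [← Nat.card_eq_fintype_card (α := G),
        Subgroup.card_eq_card_quotient_mul_card_subgroup (Subgroup.centralizer {g}), Nat.cast_mul,
        mul_inv, mul_inv_cancel_left₀]
      exact Nat.cast_ne_zero.2 Nat.card_pos.ne'
    rw [← hG, mul_assoc]
    simp [S, Representation.character]
  · intro f t
    have hlin (a y : G) : doubleModule g ρ (Double.bas a y) = doubleAction g ρ a y :=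
      Double.lin_bas _ _ _
    have hval (s : Finset G) (F : G → inducedSpace g ρ) :
        (∑ i ∈ s, F i).1 t = ∑ i ∈ s, (F i).1 t := by
      simp
    rw [hS, sweedlerPower_integral, map_smul, map_sum, LinearMap.smul_apply, LinearMap.sum_apply,
      Submodule.coe_smul, Pi.smul_apply, hval]
    congr 1
    refine (Fintype.sum_equiv (MulAut.conj t).toEquiv _ _ fun x => ?_).symm
    rw [map_sum, LinearMap.sum_apply, hval, Finset.sum_eq_single (t * g * t⁻¹)]
    · have e1 : (MulAut.conj t).toEquiv x = t * x * t⁻¹ := rfl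
      have e2 : t * g * t⁻¹ * (t * x * t⁻¹) = t * (g * x) * t⁻¹ := by group
      have e3 : t * (g * x) ^ m * t⁻¹ = t * x ^ m * t⁻¹ ↔ (g * x) ^ m = x ^ m := by simp
      rw [e1, e2, conj_zpow, conj_zpow, conj_zpow, apply_ite (doubleModule g ρ), hlin, map_zero]
      by_cases hx : (g * x) ^ m = x ^ m
      · rw [dif_pos hx, if_pos (e3.2 hx), doubleAction_apply, if_pos rfl]
        have := f.2 t (⟨_, hcomm x hx⟩⁻¹)
        rw [inv_inv] at this
        rw [← this]
        simp [mul_assoc]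
      · rw [dif_neg hx, if_neg (mt e3.1 hx)]
        rfl
    · intro a _ ha
      rw [apply_ite (doubleModule g ρ), hlin, map_zero]
      split_ifs
      · rw [doubleAction_apply, if_neg ha.symm]
      · rfl
    · simp

end Trace

/-! ### Sums of roots of unity in cyclotomic fields -/

/-- A combination of `e`-th roots of unity lies in the field generated by a primitive `d`-th root of
unity if and only if it is fixed by the automorphisms `ζ ↦ ζ ^ k` with `k ≡ 1` modulo `d`. -/
theorem sum_mem_adjoin_iff {F K ι : Type*} [Field F] [Field K] [Algebra F K] {d e : ℕ} [NeZero e]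
    [IsCyclotomicExtension {e} F K] (hirr : Irreducible (Polynomial.cyclotomic e F)) [IsGalois F K]
    [FiniteDimensional F K] (hd : d ∣ e) {ξ : K} (hξ : IsPrimitiveRoot ξ d) (s : Finset ι)
    (c : ι → F) (w : ι → K) (hw : ∀ i ∈ s, w i ^ e = 1) :
    ∑ i ∈ s, algebraMap F K (c i) * w i ∈ IntermediateField.adjoin F {ξ} ↔
      ∀ k : ℕ, k.Coprime e → k ≡ 1 [MOD d] →
        ∑ i ∈ s, algebraMap F K (c i) * w i ^ k = ∑ i ∈ s, algebraMap F K (c i) * w i := by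
  have hd0 : d ≠ 0 := fun h => NeZero.ne e (Nat.eq_zero_of_zero_dvd (h ▸ hd))
  have hξe : ξ ^ e = 1 := by
    obtain ⟨c, rfl⟩ := hd
    rw [pow_mul, hξ.pow_eq_one, one_pow]
  have hξpow (k : ℕ) : ξ ^ k = ξ ↔ k ≡ 1 [MOD d] := by
    have h := (isOfFinOrder_iff_pow_eq_one.2
      ⟨d, Nat.pos_of_ne_zero hd0, hξ.pow_eq_one⟩).pow_eq_pow_iff_modEq (n := k) (m := 1)
    rwa [pow_one, ← hξ.eq_orderOf] at h
  have hσsum (σ : Gal(K/F)) (k : ℕ) (hσ : ∀ v : K, v ^ e = 1 → σ v = v ^ k) :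
      σ (∑ i ∈ s, algebraMap F K (c i) * w i) = ∑ i ∈ s, algebraMap F K (c i) * w i ^ k := by
    rw [map_sum]
    refine Finset.sum_congr rfl fun i hi => ?_
    rw [map_mul, AlgEquiv.commutes, hσ _ (hw i hi)]
  have hspec (σ : Gal(K/F)) (v : K) (hv : v ^ e = 1) :
      σ v = v ^ ((IsCyclotomicExtension.zeta_spec e F K).autToPow F σ : ZMod e).val := by
    obtain ⟨j, -, rfl⟩ := (IsCyclotomicExtension.zeta_spec e F K).eq_pow_of_pow_eq_one hv
    rw [map_pow, ← (IsCyclotomicExtension.zeta_spec e F K).autToPow_spec F σ, ← pow_mul, mul_comm,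
      pow_mul]
  have hfix (σ : Gal(K/F)) :
      σ ∈ (IntermediateField.adjoin F {ξ}).fixingSubgroup ↔ σ ξ = ξ := by
    rw [← Subgroup.zpowers_le, ← IntermediateField.le_iff_le,
      IntermediateField.adjoin_simple_le_iff, IntermediateField.mem_fixedField_iff]
    constructor
    · exact fun h => h σ (Subgroup.mem_zpowers σ)
    · rintro h _ ⟨n, rfl⟩
      have hst : σ ∈ MulAction.stabilizer Gal(K/F) ξ := h
      exact zpow_mem hst n
  rw [← IsGalois.fixedField_fixingSubgroup (IntermediateField.adjoin F {ξ}),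
    IntermediateField.mem_fixedField_iff]
  constructor
  · intro h k hk hkd
    -- Irreducibility of the cyclotomic polynomial realizes every k prime to e by an automorphism.
    let σ := (IsCyclotomicExtension.autEquivPow K hirr).symm (ZMod.unitOfCoprime k hk)
    have hσ (v : K) (hv : v ^ e = 1) : σ v = v ^ k := by
      have h1 : (IsCyclotomicExtension.zeta_spec e F K).autToPow F σ = ZMod.unitOfCoprime k hk :=
        (IsCyclotomicExtension.autEquivPow K hirr).apply_symm_apply _
      rw [hspec σ v hv, h1, ZMod.coe_unitOfCoprime, ZMod.val_natCast]
      exact (pow_eq_pow_mod k hv).symm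
    rw [← hσsum σ k hσ]
    refine h σ ((hfix σ).2 ?_)
    rwa [hσ _ hξe, hξpow]
  · intro h σ hσ
    rw [hfix, hspec σ _ hξe, hξpow] at hσ
    rw [hσsum σ _ (hspec σ)]
    exact h _ (ZMod.val_coe_unit_coprime _) hσ

/-- A rational combination of `e`-th roots of unity lies in `ℚ(ζ_d)` if and only if it is fixed by
the Galois automorphisms `ζ ↦ ζ ^ k` with `k ≡ 1` modulo `d`. -/
theorem sum_mem_cyclotomicSubfield_iff {ι : Type*} (s : Finset ι) (c : ι → ℚ) (w : ι → ℂ)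
    {d e : ℕ} (he : e ≠ 0) (hd : d ∣ e) (hw : ∀ i ∈ s, w i ^ e = 1) :
    ∑ i ∈ s, (c i : ℂ) * w i ∈ cyclotomicSubfield d ↔
      ∀ k : ℕ, k.Coprime e → k ≡ 1 [MOD d] →
        ∑ i ∈ s, (c i : ℂ) * w i ^ k = ∑ i ∈ s, (c i : ℂ) * w i := by
  have : NeZero e := ⟨he⟩
  have hd0 : d ≠ 0 := fun h => he (Nat.eq_zero_of_zero_dvd (h ▸ hd))
  let K := CyclotomicField e ℚ
  have : IsCyclotomicExtension {e} ℚ K := by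
    convert CyclotomicField.isCyclotomicExtension e ℚ
    · rfl
    · exact Subsingleton.elim _ _
  have : FiniteDimensional ℚ K := IsCyclotomicExtension.finite_of_singleton e ℚ K
  have : IsGalois ℚ K := IsCyclotomicExtension.isGalois {e} ℚ K
  -- All roots of unity involved lie in the image of f, so membership can be tested in the finite
  -- Galois extension K.
  let f : K →ₐ[ℚ] ℂ := IsAlgClosed.lift
  have hf : Function.Injective f := f.injective
  have hζ : IsPrimitiveRoot (f (IsCyclotomicExtension.zeta e ℚ K)) e :=
    (IsCyclotomicExtension.zeta_spec e ℚ K).map_of_injective hf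
  have hrange (v : ℂ) (hv : v ^ e = 1) : v ∈ Set.range f := by
    obtain ⟨j, -, rfl⟩ := hζ.eq_pow_of_pow_eq_one hv
    exact ⟨_, map_pow f _ j⟩
  have hexp := Complex.isPrimitiveRoot_exp d hd0
  obtain ⟨ξ, hξ⟩ := hrange (Complex.exp (2 * Real.pi * Complex.I / d)) (by
    obtain ⟨c, rfl⟩ := hd
    rw [pow_mul, hexp.pow_eq_one, one_pow])
  have hξd : IsPrimitiveRoot ξ d :=
    IsPrimitiveRoot.of_map_of_injective (f := f) (hξ ▸ hexp) hf
  choose! w' hw' using fun i (hi : i ∈ s) => hrange (w i) (hw i hi)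
  have hsum (k : ℕ) : ∑ i ∈ s, (c i : ℂ) * w i ^ k =
      f (∑ i ∈ s, algebraMap ℚ K (c i) * w' i ^ k) := by
    rw [map_sum]
    refine Finset.sum_congr rfl fun i hi => ?_
    rw [map_mul, map_pow, hw' i hi, AlgHom.commutes]
    rfl
  have hsum1 := hsum 1
  simp only [pow_one] at hsum1
  have hmem (x : K) : f x ∈ cyclotomicSubfield d ↔ x ∈ IntermediateField.adjoin ℚ {ξ} := by
    rw [cyclotomicSubfield, ← hξ, ← Set.image_singleton, ← IntermediateField.adjoin_map,
      IntermediateField.mem_map]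
    exact ⟨fun ⟨y, hy, hyx⟩ => hf hyx ▸ hy, fun hx => ⟨x, hx, rfl⟩⟩
  rw [hsum1, hmem, sum_mem_adjoin_iff
    (Polynomial.cyclotomic.irreducible_rat (Nat.pos_of_ne_zero he)) hd hξd s c w' fun i hi =>
      hf (by rw [map_pow, hw' i hi, hw i hi, map_one])]
  simp only [hsum, hf.eq_iff]

/-! ### Characters -/

/-- Since X^e - 1 is separable, f is diagonalizable. The same eigenvalues and multiplicities serve
every k, which is what makes χ(h^k) the Galois conjugate of χ(h). -/
theorem trace_pow_eq_sum {V : Type*} [AddCommGroup V] [Module ℂ V] [FiniteDimensional ℂ V]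
    (f : Module.End ℂ V) {e : ℕ} (he : e ≠ 0) (hf : f ^ e = 1) :
    ∃ (s : Finset ℂ) (n : ℂ → ℕ), (∀ μ ∈ s, μ ^ e = 1) ∧
      ∀ k : ℕ, LinearMap.trace ℂ V (f ^ k) = ∑ μ ∈ s, (n μ : ℂ) * μ ^ k := by
  have hss : f.IsSemisimple := by
    refine Module.End.isSemisimple_of_squarefree_aeval_eq_zero
      (p := Polynomial.X ^ e - Polynomial.C 1) ?_ (by simp [hf])
    exact ((Polynomial.separable_X_pow_sub_C 1 (Nat.cast_ne_zero.2 he) one_ne_zero)).squarefree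
  have hint := DirectSum.isInternal_submodule_of_iSupIndep_of_iSup_eq_top
    f.eigenspaces_iSupIndep hss.iSup_eigenspace_eq_top
  have hfin : {μ | f.eigenspace μ ≠ ⊥}.Finite :=
    WellFoundedGT.finite_ne_bot_of_iSupIndep f.eigenspaces_iSupIndep
  have hpow (μ : ℂ) (k : ℕ) (v : V) (hv : v ∈ f.eigenspace μ) : (f ^ k) v = μ ^ k • v := by
    rw [Module.End.mem_eigenspace_iff] at hv
    induction k with
    | zero => simp
    | succ k ih => rw [pow_succ', Module.End.mul_apply, ih, map_smul, hv, smul_smul, pow_succ]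
  refine ⟨hfin.toFinset, fun μ => Module.finrank ℂ (f.eigenspace μ), ?_, ?_⟩
  · intro μ hμ
    obtain ⟨v, hv, hv0⟩ := (Submodule.ne_bot_iff _).1 (hfin.mem_toFinset.1 hμ)
    have := hpow μ e v hv
    rw [hf, Module.End.one_apply] at this
    refine smul_left_injective ℂ hv0 ?_
    simpa using this.symm
  · intro k
    have hmaps (μ : ℂ) : Set.MapsTo (f ^ k) (f.eigenspace μ) (f.eigenspace μ) := fun v hv => by
      rw [hpow μ k v hv]
      exact Submodule.smul_mem _ _ hv
    rw [LinearMap.trace_eq_sum_trace_restrict' hint hfin hmaps]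
    refine Finset.sum_congr rfl fun μ _ => ?_
    have : (f ^ k).restrict (hmaps μ) = μ ^ k • LinearMap.id := by
      ext v
      exact hpow μ k v v.2
    rw [this, map_smul, LinearMap.trace_id, smul_eq_mul, mul_comm]

section ModuleRepresentation

variable {H : Type*} [Group H]

/-- The representation on a module over the group algebra. -/
def moduleRepresentation (N : Type*) [AddCommGroup N] [Module ℂ N] [Module (MonoidAlgebra ℂ H) N]
    [IsScalarTower ℂ (MonoidAlgebra ℂ H) N] : Representation ℂ H N :=
  ((Algebra.lsmul ℂ ℂ N : MonoidAlgebra ℂ H →ₐ[ℂ] Module.End ℂ N) :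
    MonoidAlgebra ℂ H →* Module.End ℂ N).comp (MonoidAlgebra.of ℂ H)

theorem moduleRepresentation_apply (N : Type*) [AddCommGroup N] [Module ℂ N]
    [Module (MonoidAlgebra ℂ H) N] [IsScalarTower ℂ (MonoidAlgebra ℂ H) N] (h : H) (x : N) :
    moduleRepresentation N h x = MonoidAlgebra.single h (1 : ℂ) • x := rfl

theorem moduleRepresentation_isIrreducible (N : Type*) [AddCommGroup N] [Module ℂ N]
    [Module (MonoidAlgebra ℂ H) N] [IsScalarTower ℂ (MonoidAlgebra ℂ H) N]
    [IsSimpleModule (MonoidAlgebra ℂ H) N] :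
    (moduleRepresentation (H := H) N).IsIrreducible where
  exists_pair_ne := by
    have := IsSimpleModule.nontrivial (MonoidAlgebra ℂ H) N
    refine ⟨⊥, ⊤, fun h => ?_⟩
    exact bot_ne_top (α := Submodule ℂ N) (congrArg Subrepresentation.toSubmodule h)
  eq_bot_or_eq_top W := by
    let W' : Submodule (MonoidAlgebra ℂ H) N :=
      { W.toSubmodule with
        smul_mem' := by
          intro c x hx
          change c • x ∈ W.toSubmodule
          induction c using MonoidAlgebra.induction_linear with
          | zero => rw [zero_smul]; exact zero_mem _
          | add a b ha hb => rw [add_smul]; exact add_mem ha hb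
          | single h a =>
            have e : MonoidAlgebra.single h a = a • MonoidAlgebra.single h (1 : ℂ) := by simp
            rw [e, smul_assoc]
            exact Submodule.smul_mem _ _ (W.apply_mem_toSubmodule h hx) }
    refine (eq_bot_or_eq_top W').imp (fun h => ?_) fun h => ?_ <;>
      refine SetLike.ext fun x => ?_
    · exact SetLike.ext_iff.1 h x
    · exact SetLike.ext_iff.1 h x

end ModuleRepresentation

section ClassFunctions

variable {H : Type u} [Group H] [Fintype H]

/-- By Schur's lemma, a class function orthogonal to an irreducible character acts as zero. -/
theorem sum_smul_eq_zero_of_irreducible {V : Type*} [AddCommGroup V] [Module ℂ V]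
    [FiniteDimensional ℂ V] (ρ : Representation ℂ H V) (hρ : ρ.IsIrreducible) (F : H → ℂ)
    (hF : ∀ u h, F (u * h * u⁻¹) = F h) (h0 : ∑ h, F h * ρ.character h = 0) :
    ∑ h, F h • ρ h = 0 := by
  have hcomm (u : H) : (∑ h, F h • ρ h) * ρ u = ρ u * ∑ h, F h • ρ h := by
    rw [Finset.sum_mul, Finset.mul_sum]
    refine Fintype.sum_equiv (MulAut.conj u⁻¹).toEquiv _ _ fun h => ?_
    have e : (MulAut.conj u⁻¹).toEquiv h = u⁻¹ * h * u⁻¹⁻¹ := rfl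
    rw [e, hF, smul_mul_assoc, mul_smul_comm, ← map_mul, ← map_mul]
    congr 2
    group
  let φ : Representation.IntertwiningMap ρ ρ :=
    { toLinearMap := ∑ h, F h • ρ h
      isIntertwining' := fun u => hcomm u }
  have := hρ
  obtain ⟨c, hc⟩ :=
    (Representation.IsIrreducible.algebraMap_intertwiningMap_bijective_of_isAlgClosed (ρ := ρ)).2 φ
  have hc' : ∑ h, F h • ρ h = c • (1 : Module.End ℂ V) := by
    have := congrArg Representation.IntertwiningMap.toLinearMap hc
    exact this.symm
  have htr := congrArg (LinearMap.trace ℂ V) hc'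
  rw [map_smul, LinearMap.trace_one, map_sum] at htr
  have : Nontrivial V := by
    by_contra hV
    rw [not_nontrivial_iff_subsingleton] at hV
    obtain ⟨a, b, hab⟩ := hρ.toNontrivial
    exact hab (Subrepresentation.toSubmodule_injective (Subsingleton.elim _ _))
  have hfr : (Module.finrank ℂ V : ℂ) ≠ 0 := Nat.cast_ne_zero.2 Module.finrank_pos.ne'
  have : c = 0 := by
    refine (mul_eq_zero.1 (htr.symm.trans ?_)).resolve_right hfr
    simpa [Representation.character] using h0
  rw [hc', this, zero_smul]

/-- The irreducible characters span the class functions. -/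
theorem classFunction_eq_zero (F : H → ℂ) (hF : ∀ u h, F (u * h * u⁻¹) = F h)
    (h0 : ∀ (V : Type u) [AddCommGroup V] [Module ℂ V] [FiniteDimensional ℂ V]
      (ρ : Representation ℂ H V), ρ.IsIrreducible → ∑ h, F h * ρ.character h = 0) (h : H) :
    F h = 0 := by
  -- As a group algebra element, F kills every simple left ideal, hence the whole semisimple
  -- algebra, hence 1. These ideals live in `Type u`, so testing representations in that universe
  -- suffices.
  let c : MonoidAlgebra ℂ H := ∑ h, MonoidAlgebra.single h (F h)
  have hsimple (N : Submodule (MonoidAlgebra ℂ H) (MonoidAlgebra ℂ H))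
      (hN : IsSimpleModule (MonoidAlgebra ℂ H) N) (x : N) : c • x = 0 := by
    have : FiniteDimensional ℂ N := Module.Finite.trans (MonoidAlgebra ℂ H) _
    have h1 := sum_smul_eq_zero_of_irreducible (moduleRepresentation N)
      (moduleRepresentation_isIrreducible N) F hF
      (h0 _ _ (moduleRepresentation_isIrreducible N))
    have h2 := LinearMap.congr_fun h1 x
    rw [LinearMap.sum_apply] at h2
    rw [Finset.sum_smul]
    refine Eq.trans (Finset.sum_congr rfl fun h _ => ?_) h2
    rw [LinearMap.smul_apply, moduleRepresentation_apply, ← smul_assoc, MonoidAlgebra.smul_single,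
      smul_eq_mul, mul_one]
  have hall (x : MonoidAlgebra ℂ H) : c • x = 0 := by
    have hx : x ∈ sSup {N : Submodule (MonoidAlgebra ℂ H) (MonoidAlgebra ℂ H) |
        IsSimpleModule (MonoidAlgebra ℂ H) N} := by
      rw [IsSemisimpleModule.sSup_simples_eq_top]
      trivial
    rw [sSup_eq_iSup'] at hx
    induction hx using Submodule.iSup_induction' with
    | mem N x hx => exact congrArg Subtype.val (hsimple N.1 N.2 ⟨x, hx⟩)
    | zero => exact smul_zero _
    | add x y _ _ hx hy => rw [smul_add, hx, hy, add_zero]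
  have hc : c = 0 := by simpa using hall 1
  classical
  have := congrArg (fun y : MonoidAlgebra ℂ H => y.coeff h) hc
  simpa [c, MonoidAlgebra.coeff_sum, MonoidAlgebra.coeff_single, Finsupp.single_apply] using this

theorem sum_character_mem_cyclotomicSubfield_iff {V : Type*} [AddCommGroup V] [Module ℂ V]
    [FiniteDimensional ℂ V] (ρ : Representation ℂ H V) (F : H → ℚ) {d e : ℕ} (he : e ≠ 0)
    (hd : d ∣ e) (hH : ∀ h : H, h ^ e = 1) :
    ∑ h, (F h : ℂ) * ρ.character h ∈ cyclotomicSubfield d ↔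
      ∀ k : ℕ, k.Coprime e → k ≡ 1 [MOD d] →
        ∑ h, (F h : ℂ) * ρ.character (h ^ k) = ∑ h, (F h : ℂ) * ρ.character h := by
  choose s n hs hn using fun h : H => trace_pow_eq_sum (ρ h) he (by rw [← map_pow, hH, map_one])
  have key (k : ℕ) : ∑ h, (F h : ℂ) * ρ.character (h ^ k) =
      ∑ x ∈ Finset.univ.sigma s, ((F x.1 * n x.1 x.2 : ℚ) : ℂ) * x.2 ^ k := by
    rw [Finset.sum_sigma]
    refine Finset.sum_congr rfl fun h _ => ?_
    rw [Representation.character, map_pow, hn, Finset.mul_sum]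
    refine Finset.sum_congr rfl fun μ _ => ?_
    push_cast
    ring
  have key1 := key 1
  simp only [pow_one] at key1
  rw [key1, sum_mem_cyclotomicSubfield_iff _ _ _ he hd]
  · simp only [key]
  · exact fun x hx => hs x.1 x.2 (Finset.mem_sigma.1 hx).2

/-- Reindexing by the bijection h ↦ h^k moves the Galois action from χ to F: with l inverse to k mod
e, F(h^l) - F(h) is a class function orthogonal to all irreducible characters. -/
theorem forall_sum_character_mem_iff (F : H → ℚ) (hF : ∀ u h, F (u * h * u⁻¹) = F h) {d e : ℕ}
    (he : e ≠ 0) (hd : d ∣ e) (hH : ∀ h : H, h ^ e = 1) :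
    (∀ (V : Type u) [AddCommGroup V] [Module ℂ V] [FiniteDimensional ℂ V]
      (ρ : Representation ℂ H V), ρ.IsIrreducible →
        ∑ h, (F h : ℂ) * ρ.character h ∈ cyclotomicSubfield d) ↔
      ∀ k : ℕ, k.Coprime e → k ≡ 1 [MOD d] → ∀ h, F (h ^ k) = F h := by
  have hexp : ∀ k : ℕ, k.Coprime e → ∃ l : ℕ, ∀ h : H, (h ^ k) ^ l = h ∧ (h ^ l) ^ k = h := by
    intro k hk
    have : NeZero e := ⟨he⟩
    let u := ZMod.unitOfCoprime k hk
    have hl : k * (u⁻¹ : (ZMod e)ˣ).val.val ≡ 1 [MOD e] := by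
      rw [← ZMod.natCast_eq_natCast_iff, Nat.cast_mul, ZMod.natCast_zmod_val, Nat.cast_one]
      exact u.mul_inv
    have hpow (h : H) : h ^ (k * (u⁻¹ : (ZMod e)ˣ).val.val) = h := by
      conv_rhs => rw [← pow_one h]
      exact pow_eq_pow_iff_modEq.2 (hl.of_dvd (orderOf_dvd_of_pow_eq_one (hH h)))
    exact ⟨_, fun h => ⟨by rw [← pow_mul, hpow], by rw [← pow_mul, mul_comm, hpow]⟩⟩
  constructor
  · intro h k hk hkd x
    obtain ⟨l, hl⟩ := hexp k hk
    let eqv : H ≃ H := ⟨(· ^ k), (· ^ l), fun h => (hl h).1, fun h => (hl h).2⟩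
    have hz := classFunction_eq_zero (fun h => (F (h ^ l) : ℂ) - F h)
      (fun u h => by rw [conj_pow, hF, hF]) (fun V _ _ _ ρ hρ => by
        have h1 := (sum_character_mem_cyclotomicSubfield_iff ρ F he hd hH).1 (h V ρ hρ) k hk hkd
        simp only [sub_mul]
        rw [Finset.sum_sub_distrib, ← h1, sub_eq_zero]
        refine (Fintype.sum_equiv eqv _ _ fun y => ?_).symm
        change _ = (F ((y ^ k) ^ l) : ℂ) * ρ.character (y ^ k)
        rw [(hl y).1]) (x ^ k)
    simp only [(hl x).1, sub_eq_zero] at hz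
    exact (Rat.cast_injective hz).symm
  · intro h V _ _ _ ρ _
    rw [sum_character_mem_cyclotomicSubfield_iff ρ F he hd hH]
    intro k hk hkd
    obtain ⟨l, hl⟩ := hexp k hk
    let eqv : H ≃ H := ⟨(· ^ k), (· ^ l), fun h => (hl h).1, fun h => (hl h).2⟩
    refine Fintype.sum_equiv eqv _ _ fun y => ?_
    change _ = (F (y ^ k) : ℂ) * ρ.character (y ^ k)
    rw [h k hk hkd]

end ClassFunctions

/-! ### Indicators and root counts -/

theorem ncard_rootSet_conj {G : Type u} [Group G] (m : ℤ) {u g : G} (hu : Commute u g) (z : G) :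
    (rootSet m g (u * z * u⁻¹)).ncard = (rootSet m g z).ncard := by
  refine (Set.ncard_congr (fun x _ => u * x * u⁻¹) ?_ ?_ ?_).symm
  · rintro x ⟨h1, h2⟩
    have e : g * (u * x * u⁻¹) = u * (g * x) * u⁻¹ := by
      rw [← mul_assoc, ← mul_assoc, ← hu.eq, mul_assoc u]
    exact ⟨by rw [conj_zpow, h1], by rw [e, conj_zpow, h2]⟩
  · intro x y _ _ h
    simpa using h
  · rintro x ⟨h1, h2⟩
    have e : g * (u⁻¹ * x * u) = u⁻¹ * (g * x) * u := by
      rw [← mul_assoc, ← mul_assoc, ← hu.inv_left.eq, mul_assoc u⁻¹]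
    have c (y : G) (hy : y ^ m = u * z * u⁻¹) : (u⁻¹ * y * u) ^ m = z := by
      have := conj_zpow (i := m) (a := u⁻¹) (b := y)
      rw [inv_inv] at this
      rw [this, hy]
      group
    exact ⟨u⁻¹ * x * u, ⟨c x h1, by rw [e, c _ h2]⟩, by group⟩

/-- The indicators `ν_m(g, η)` lie in `ℚ(ζ_d)` if and only if `z ↦ γ_m^z(g)` is invariant under
`z ↦ z ^ k` for `k ≡ 1` modulo `d`. -/
theorem forall_frobeniusSchur_mem_iff {G : Type u} [Group G] [Fintype G] (m : ℤ) (d : ℕ)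
    (hd : d ∣ Monoid.exponent G) (g : G) :
    (∀ (V : Type u) [AddCommGroup V] [Module ℂ V] [FiniteDimensional ℂ V]
        (η : Representation ℂ (Subgroup.centralizer {g}) V), η.IsIrreducible →
        frobeniusSchur g η m ∈ cyclotomicSubfield d) ↔
      ∀ k : ℕ, k.Coprime (Monoid.exponent G) → k ≡ 1 [MOD d] → ∀ z : G, Commute g z →
        (rootSet m g (z ^ k)).ncard = (rootSet m g z).ncard := by
  classical
  have hC (u : Subgroup.centralizer {g}) : Commute (u : G) g :=
    Subgroup.mem_centralizer_singleton_iff.1 u.2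
  let F : Subgroup.centralizer {g} → ℚ := fun h =>
    (Nat.card (Subgroup.centralizer {g}) : ℚ)⁻¹ * (rootSet m g (h : G)⁻¹).ncard
  have hF (u h) : F (u * h * u⁻¹) = F h := by
    have e : (((u * h * u⁻¹ : Subgroup.centralizer {g}) : G))⁻¹ = u * (h : G)⁻¹ * (u : G)⁻¹ := by
      simp [mul_assoc]
    simp only [F]
    rw [e, ncard_rootSet_conj m (hC u)]
  have hν (V : Type u) [AddCommGroup V] [Module ℂ V] [FiniteDimensional ℂ V]
      (η : Representation ℂ (Subgroup.centralizer {g}) V) :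
      frobeniusSchur g η m = ∑ h, (F h : ℂ) * η.character h := by
    rw [frobeniusSchur_eq, Finset.mul_sum]
    refine Finset.sum_congr rfl fun h _ => ?_
    simp only [F]
    push_cast
    ring
  have hcard : (Nat.card (Subgroup.centralizer {g}) : ℚ)⁻¹ ≠ 0 :=
    inv_ne_zero (Nat.cast_ne_zero.2 Nat.card_pos.ne')
  have hexp (h : Subgroup.centralizer {g}) : h ^ Monoid.exponent G = 1 :=
    Subtype.ext (Monoid.pow_exponent_eq_one (h : G))
  refine Iff.trans ?_ ((forall_sum_character_mem_iff F hF Monoid.exponent_ne_zero_of_finite hd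
    hexp).trans ?_)
  · constructor <;> intro h V _ _ _ η hη
    · rw [← hν]
      exact h V η hη
    · rw [hν]
      exact h V η hη
  refine forall_congr' fun k => imp_congr_right fun _ => imp_congr_right fun _ => ?_
  constructor
  · intro h z hz
    have := h ⟨z⁻¹, Subgroup.mem_centralizer_singleton_iff.2 hz.symm.inv_left.eq⟩
    simpa [F, hcard, ← inv_pow] using this
  · intro h x
    have := h (x : G)⁻¹ (hC x).symm.inv_right
    simp only [F]
    rw [Subgroup.coe_pow, ← inv_pow, this]

end DrinfeldIndicator

end

theorem mainTheorem6 {G : Type u} [Group G] [Fintype G] (m : ℤ) (d : ℕ)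
    (hd : d ∣ Monoid.exponent G) :
    (∀ (g : G) (V : Type u) [AddCommGroup V] [Module ℂ V] [FiniteDimensional ℂ V]
        (η : Representation ℂ (Subgroup.centralizer {g}) V), η.IsIrreducible →
        DrinfeldIndicator.frobeniusSchur g η m ∈ DrinfeldIndicator.cyclotomicSubfield d) ↔
      ∀ (z : G) (r : ℤ), IsCoprime r (Monoid.exponent G : ℤ) → r ≡ 1 [ZMOD d] →
        DrinfeldIndicator.adams r (DrinfeldIndicator.gamma m z) =
          DrinfeldIndicator.gamma m z := by
  have hγ (z : G) (g : Subgroup.centralizer {z}) : Commute (g : G) z :=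
    Subgroup.mem_centralizer_singleton_iff.1 g.2
  constructor
  · intro h z r hr hrd
    -- The integer r may be negative; Dirichlet's theorem supplies a natural number k in its class
    -- modulo the exponent.
    obtain ⟨k, -, -, hk⟩ := Nat.forall_exists_prime_gt_and_zmodEq 0
      Monoid.exponent_ne_zero_of_finite hr
    have hkd : k ≡ 1 [MOD d] := by
      rw [← Int.natCast_modEq_iff]
      exact (hk.of_dvd (Int.natCast_dvd_natCast.2 hd)).trans hrd
    have hkc : k.Coprime (Monoid.exponent G) := by
      rw [← Nat.isCoprime_iff_coprime]
      obtain ⟨c, hc⟩ := hk.symm.dvd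
      have : (k : ℤ) = r + Monoid.exponent G * c := by linarith
      rw [this]
      exact hr.add_mul_left_left c
    ext g
    have hg : ((g ^ r : Subgroup.centralizer {z}) : G) = (g : G) ^ k := by
      rw [Subgroup.coe_zpow, ← zpow_natCast, zpow_eq_zpow_iff_modEq]
      exact hk.symm.of_dvd (Int.natCast_dvd_natCast.2 (Monoid.order_dvd_exponent _))
    -- The chain is |G_m(g,z)| = |G_m(g^k,z^k)| = |G_m(g^k,z)|: the bridge, then invariance in z at
    -- the element g^k.
    rw [DrinfeldIndicator.adams, DrinfeldIndicator.gamma, DrinfeldIndicator.gamma, hg,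
      DrinfeldIndicator.ncard_rootSet_pow m k hkc (hγ z g),
      (DrinfeldIndicator.forall_frobeniusSchur_mem_iff m d hd ((g : G) ^ k)).1 (h _) k hkc hkd z
        ((hγ z g).pow_left k)]
  · intro h g
    refine (DrinfeldIndicator.forall_frobeniusSchur_mem_iff m d hd g).2 ?_
    intro k hkc hkd z hz
    -- Invariance of γ at z^k gives |G_m(g^k,z^k)| = |G_m(g,z^k)|, and the left side is |G_m(g,z)|
    -- by the bridge.
    have := congrFun (h (z ^ k) k (Nat.isCoprime_iff_coprime.2 hkc)
      (by exact_mod_cast Int.natCast_modEq_iff.2 hkd))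
      ⟨g, Subgroup.mem_centralizer_singleton_iff.2 (hz.pow_right k).eq⟩
    rw [DrinfeldIndicator.ncard_rootSet_pow m k hkc hz]
    simpa [DrinfeldIndicator.adams, DrinfeldIndicator.gamma] using this.symm
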